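/- Let $H$ be a complex Hilbert space and $B(H)$ the algebra of bounded operators on $H$. Let $A,X,B\in B(H)$, where $A$ and $B$ are positive definite, i.e. positive and invertible. For real $\nu$ and $\alpha$ put $$H_\nu(A,X,B)=\frac{A^{\nu}XB^{1-\nu}+A^{1-\nu}XB^{\nu}}{2},\qquad \mathcal F_\alpha(A,X,B)=(1-\alpha)A^{1/2}XB^{1/2}+\alpha\,\frac{AX+XB}{2}.$$ Let $|||\cdot|||$ be a unitarily invariant norm, that is, a norm on a two-sided ideal $J$ of $B(H)$ (possibly $J=B(H)$) with $|||UTV|||=|||T|||$ for all $T\in J$ and all unitary $U,V\in B(H)$; put $|||T|||=\infty$ for $T\in B(H)\setminus J$. Assume that $X\in J$ or that $J$ is complete with respect to $|||\cdot|||$ (so there is no restriction on $X$ if $J=B(H)$ or if $J$ is a Banach ideal). Let $\frac12\le\beta\le1$ and $\alpha\ge\frac12$. (1) If $\frac38\le\nu\le\frac58$, then $$|||H_\nu(A,X,B)|||\le\left|\left|\left|(1-\beta)A^{1/2}XB^{1/2}+\beta H_{1/4}(A,X,B)\right|\right|\right|\le|||\mathcal F_\alpha(A,X,B)|||.$$ (2)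 If $\frac5{16}\le\nu\le\frac{11}{16}$, then $$|||H_\nu(A,X,B)|||\le\left|\left|\left|(1-\beta)H_{3/8}(A,X,B)+\beta H_{1/4}(A,X,B)\right|\right|\right|\le|||\mathcal F_\alpha(A,X,B)|||.$$ -/

import Mathlib

open scoped ENNReal

noncomputable section

/-- A unitarily invariant norm `|||·|||` on the operators of a Hilbert space `H`.

As usual on an infinite-dimensional space, such a norm may be finite only on a two-sided ideal of
bounded operators; outside of it we put `|||T||| = ∞`.  (The set `{T | |||T||| < ∞}` is
automatically a two-sided ideal, because every bounded operator is a linear combination of unitary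
ones.  Conversely, each norm on a two-sided ideal `J` with `|||U T V||| = |||T|||` for `T ∈ J` and
`U`, `V` unitary, extended by `∞` outside `J`, is of this form.  Norms that are finite on all
bounded operators are the case `J = B(H)`.) -/
structure UnitarilyInvariantNorm (H : Type*) [NormedAddCommGroup H] [InnerProductSpace ℂ H]
    [CompleteSpace H] where
  /-- the value `|||T|||` -/
  toFun : (H →L[ℂ] H) → ℝ≥0∞
  eq_zero' : ∀ T, toFun T = 0 → T = 0
  add_le' : ∀ S T, toFun (S + T) ≤ toFun S + toFun T
  smul' : ∀ (c : ℂ) (T : H →L[ℂ] H), toFun (c • T) = ‖c‖ₑ * toFun T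
  unitary_mul_mul' : ∀ U ∈ unitary (H →L[ℂ] H), ∀ V ∈ unitary (H →L[ℂ] H), ∀ T,
    toFun (U * T * V) = toFun T

namespace UnitarilyInvariantNorm

variable {H : Type*} [NormedAddCommGroup H] [InnerProductSpace ℂ H] [CompleteSpace H]

instance : CoeFun (UnitarilyInvariantNorm H) (fun _ => (H →L[ℂ] H) → ℝ≥0∞) := ⟨toFun⟩

/-- The ideal `{T | |||T||| < ∞}` is complete with respect to `|||·|||`: every Cauchy sequence of
operators of finite norm converges in this norm to an operator of finite norm. -/
def IsComplete (N : UnitarilyInvariantNorm H) : Prop :=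
  ∀ u : ℕ → (H →L[ℂ] H), (∀ n, N (u n) < ∞) →
    (∀ ε : ℝ≥0∞, 0 < ε → ∃ n₀, ∀ m, n₀ ≤ m → ∀ n, n₀ ≤ n → N (u m - u n) < ε) →
    ∃ L : H →L[ℂ] H, N L < ∞ ∧ ∀ ε : ℝ≥0∞, 0 < ε → ∃ n₀, ∀ n, n₀ ≤ n → N (u n - L) < ε

end UnitarilyInvariantNorm

section Means

variable {H : Type*} [NormedAddCommGroup H] [InnerProductSpace ℂ H] [CompleteSpace H]

/-- The Heinz mean `H_ν(A, X, B) = (A^ν X B^(1-ν) + A^(1-ν) X B^ν) / 2`; the powers are those of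
the continuous functional calculus. -/
def heinzMean (ν : ℝ) (A X B : H →L[ℂ] H) : H →L[ℂ] H :=
  (1 / 2 : ℝ) • (A ^ ν * X * B ^ (1 - ν) + A ^ (1 - ν) * X * B ^ ν)

/-- The Heron mean `F_α(A, X, B) = (1 - α) A^(1/2) X B^(1/2) + α (A X + X B) / 2`. -/
def heronMean (α : ℝ) (A X B : H →L[ℂ] H) : H →L[ℂ] H :=
  (1 - α) • (A ^ (1 / 2 : ℝ) * X * B ^ (1 / 2 : ℝ)) + α • ((1 / 2 : ℝ) • (A * X + X * B))

end Means

end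

/-!
Put `Y = A^(1/2) X B^(1/2)` and let `D T = (log A) T - T (log B)`. Then `exp (z D)` is the map
`T ↦ A^z T B^(-z)`, the Heinz mean is `H_ν = cosh ((ν - 1/2) D) Y`, and all operators in the theorem
are linear combinations of `Y` and of `C_s Y`, where `C_s = cosh (s D)`. The maps `exp (i t D)` are
isometries for every unitarily invariant norm, as `A^(i t)` and `B^(i t)` are unitary.

The analytic core is the inequality `|||Y||| ≤ |||C_s Y|||`. Since `D` generates isometries,
`|||Y||| ≤ |||(1 + i r D) Y|||` for real `r`. The polynomials `((1 + z/n)^n + (1 - z/n)^n) / 2` have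
purely imaginary roots and the value `1` at `0`, so that evaluated at `D` they are products of such
factors and do not decrease the norm; they converge to `C_1`. The product formula for `cosh` then
makes `s ↦ |||C_s Y|||` midpoint convex; being even and continuous, it increases with `|s|`.

Everything else is the triangle inequality: if `|||P Y||| ≤ |||Q Y|||` with `Q = (P + R) / 2`, then
`|||Q Y||| ≤ |||((1 - γ) P + γ R) Y|||` for `γ ≥ 1/2`. This is used with `P = 1`, `R = C_s`,
`Q = C_{s/2} ^ 2`, and with `P = C_s`, `R = C_{2s}`, `Q = C_{s/2} C_{3s/2}`.

These arguments take place in the ideal `{T | |||T||| < ∞}`, normed by `|||·|||`. If `Y` lies outside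
and the ideal is complete, then the right-hand sides are infinite: the operators
`(1 - γ) P + γ R` are invertible on the ideal by the method of continuity, and they are injective on
all bounded operators by the same lower bounds for the operator norm.
-/

section HermitianGenerators

open Filter Topology Polynomial

/-! ### Bounded operators that do not decrease norms -/

section NormedSpace

variable {E : Type*} [NormedAddCommGroup E] [NormedSpace ℂ E]

/-- The right-hand vector is `2 γ` times the left-hand one minus `(2 γ - 1) p`. -/
lemma norm_half_add_le_norm_combo {p r : E} (h : ‖p‖ ≤ ‖(1 / 2 : ℂ) • (p + r)‖) {γ : ℝ}
    (hγ : 1 / 2 ≤ γ) :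
    ‖(1 / 2 : ℂ) • (p + r)‖ ≤ ‖((1 - γ : ℝ) : ℂ) • p + (γ : ℂ) • r‖ := by
  have e : ((2 * γ : ℝ) : ℂ) • ((1 / 2 : ℂ) • (p + r)) =
      (((1 - γ : ℝ) : ℂ) • p + (γ : ℂ) • r) + ((2 * γ - 1 : ℝ) : ℂ) • p := by
    push_cast
    module
  have h1 := norm_add_le (((1 - γ : ℝ) : ℂ) • p + (γ : ℂ) • r) (((2 * γ - 1 : ℝ) : ℂ) • p)
  rw [← e, norm_smul, norm_smul ((2 * γ - 1 : ℝ) : ℂ), Complex.norm_real, Complex.norm_real,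
    Real.norm_of_nonneg (by linarith), Real.norm_of_nonneg (by linarith)] at h1
  nlinarith

lemma norm_combo_le {p r : E} (h : ‖p‖ ≤ ‖r‖) {γ : ℝ} (h0 : 0 ≤ γ) (h1 : γ ≤ 1) :
    ‖((1 - γ : ℝ) : ℂ) • p + (γ : ℂ) • r‖ ≤ ‖r‖ := by
  refine (norm_add_le _ _).trans ?_
  rw [norm_smul, norm_smul, Complex.norm_real, Complex.norm_real,
    Real.norm_of_nonneg (by linarith), Real.norm_of_nonneg h0]
  nlinarith

lemma ContinuousLinearMap.norm_one_le : ‖(1 : E →L[ℂ] E)‖ ≤ 1 :=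
  ContinuousLinearMap.norm_id_le

lemma norm_pow_sub_pow_le {m : ℝ} (hm : 1 ≤ m) {x y : E →L[ℂ] E} (hx : ‖x‖ ≤ m) (hy : ‖y‖ ≤ m)
    (n : ℕ) : ‖x ^ n - y ^ n‖ ≤ n * m ^ n * ‖x - y‖ := by
  have hpow : ∀ n : ℕ, ‖x ^ n‖ ≤ m ^ n := by
    intro n
    induction n with
    | zero => simpa using ContinuousLinearMap.norm_one_le
    | succ n ih =>
      rw [pow_succ, pow_succ]
      exact (norm_mul_le _ _).trans (by gcongr)
  induction n with
  | zero => simp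
  | succ n ih =>
    have e : x ^ (n + 1) - y ^ (n + 1) = x ^ n * (x - y) + (x ^ n - y ^ n) * y := by
      rw [pow_succ, pow_succ]
      noncomm_ring
    rw [e]
    calc _ ≤ ‖x ^ n‖ * ‖x - y‖ + ‖x ^ n - y ^ n‖ * ‖y‖ :=
          (norm_add_le _ _).trans (add_le_add (norm_mul_le _ _) (norm_mul_le _ _))
      _ ≤ m ^ n * ‖x - y‖ + (n * m ^ n * ‖x - y‖) * m := by
          gcongr
          exact hpow n
      _ ≤ m ^ n * m * ‖x - y‖ + (n * m ^ n * ‖x - y‖) * m := by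
          gcongr
          exact le_mul_of_one_le_right (by positivity) hm
      _ = _ := by push_cast; ring

/-- An operator at distance less than one from an invertible operator that does not decrease norms
is invertible. -/
lemma isUnit_of_norm_sub_lt_one [CompleteSpace E] {u T : E →L[ℂ] E} (hu : IsUnit u)
    (hb : ∀ y, ‖y‖ ≤ ‖u y‖) (h : ‖T - u‖ < 1) : IsUnit T := by
  obtain ⟨u, rfl⟩ := hu
  have hinv : ‖((u⁻¹ : (E →L[ℂ] E)ˣ) : E →L[ℂ] E)‖ ≤ 1 := by
    refine ContinuousLinearMap.opNorm_le_bound _ zero_le_one fun y => ?_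
    have h1 := hb (((u⁻¹ : (E →L[ℂ] E)ˣ) : E →L[ℂ] E) y)
    rw [← mul_apply_eq_comp, Units.mul_inv] at h1
    simpa using h1
  have e : T = u * (1 - ((u⁻¹ : (E →L[ℂ] E)ˣ) : E →L[ℂ] E) * (u - T)) := by
    rw [mul_sub, ← mul_assoc, Units.mul_inv]
    simp
  rw [e]
  refine u.isUnit.mul (isUnit_one_sub_of_norm_lt_one ?_)
  refine (norm_mul_le _ _).trans_lt ?_
  rw [norm_sub_rev] at h
  exact (mul_le_of_le_one_left (norm_nonneg _) hinv).trans_lt h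

/-- The method of continuity along the segment from `T` to `T + S`. -/
lemma isUnit_add_of_segment [CompleteSpace E] {T S : E →L[ℂ] E} (hT : IsUnit T)
    (hb : ∀ r : ℝ, 0 ≤ r → r ≤ 1 → ∀ y, ‖y‖ ≤ ‖(T + (r : ℂ) • S) y‖) : IsUnit (T + S) := by
  obtain ⟨m, hm⟩ := exists_nat_gt ‖S‖
  have hm0 : (0 : ℝ) < m := (norm_nonneg S).trans_lt hm
  have key : ∀ k : ℕ, k ≤ m → IsUnit (T + ((k / m : ℝ) : ℂ) • S) := by
    intro k
    induction k with
    | zero => simpa using hT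
    | succ k ih =>
      intro hk
      have hk' : (k : ℝ) ≤ m := by exact_mod_cast (by omega : k ≤ m)
      refine isUnit_of_norm_sub_lt_one (ih (by omega)) (hb _ (by positivity)
        (div_le_one_of_le₀ hk' hm0.le)) ?_
      have e : T + (((k + 1 : ℕ) / m : ℝ) : ℂ) • S - (T + ((k / m : ℝ) : ℂ) • S) =
          ((1 / m : ℝ) : ℂ) • S := by
        push_cast
        rw [add_div]
        module
      rw [e, norm_smul, Complex.norm_real, Real.norm_of_nonneg (by positivity),
        one_div_mul_eq_div, div_lt_one hm0]
      exact hm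
  simpa [hm0.ne'] using key m le_rfl

lemma isUnit_combo [CompleteSpace E] {P R : E →L[ℂ] E}
    (hP : ∀ y, ‖P y‖ ≤ ‖(1 / 2 : ℂ) • (P y + R y)‖) (h1 : ∀ y, ‖y‖ ≤ ‖(1 / 2 : ℂ) • (P y + R y)‖)
    (hu : IsUnit ((1 / 2 : ℂ) • (P + R))) {γ : ℝ} (hγ : 1 / 2 ≤ γ) :
    IsUnit (((1 - γ : ℝ) : ℂ) • P + (γ : ℂ) • R) := by
  have e : ((1 - γ : ℝ) : ℂ) • P + (γ : ℂ) • R =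
      (1 / 2 : ℂ) • (P + R) + ((γ - 1 / 2 : ℝ) : ℂ) • (R - P) := by
    push_cast
    module
  rw [e]
  refine isUnit_add_of_segment hu fun r hr0 _ y => ?_
  have hγr : 1 / 2 ≤ 1 / 2 + r * (γ - 1 / 2) := by nlinarith
  refine ((h1 y).trans (norm_half_add_le_norm_combo (hP y) hγr)).trans_eq ?_
  simp only [add_apply, smul_apply, sub_apply]
  push_cast
  congr 1
  module

end NormedSpace

/-! ### Hyperbolic cosines of a Hermitian operator -/

/-- A group `z ↦ exp (z D)` of bounded operators whose generator `D` is Hermitian, in the sense that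
`exp (i t D)` is an isometry for real `t`.  The space need not be complete, so the exponential is
kept as data. -/
structure HermitianGroup (E : Type*) [NormedAddCommGroup E] [NormedSpace ℂ E] where
  /-- The operator `exp (z D)`. -/
  toFun : ℂ → (E →L[ℂ] E)
  /-- The generator `D`. -/
  gen : E →L[ℂ] E
  map_zero : toFun 0 = 1
  map_add : ∀ z w, toFun (z + w) = toFun z * toFun w
  norm_map_I : ∀ (t : ℝ) (y : E), ‖toFun (t * Complex.I) y‖ = ‖y‖
  hasDerivAt : HasDerivAt toFun gen 0

namespace HermitianGroup

variable {E : Type*} [NormedAddCommGroup E] [NormedSpace ℂ E] (G : HermitianGroup E)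

/-- The group generated by `s D`. -/
def scale (s : ℝ) : HermitianGroup E where
  toFun z := G.toFun (s * z)
  gen := (s : ℂ) • G.gen
  map_zero := by simp [G.map_zero]
  map_add z w := by rw [mul_add, G.map_add]
  norm_map_I t y := by
    rw [← mul_assoc, ← Complex.ofReal_mul, G.norm_map_I]
  hasDerivAt := by
    have h : HasDerivAt (fun z : ℂ => (s : ℂ) * z) (s : ℂ) 0 := by
      simpa using (hasDerivAt_id (0 : ℂ)).const_mul (s : ℂ)
    have h' : HasDerivAt G.toFun G.gen ((s : ℂ) * 0) := by simpa using G.hasDerivAt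
    exact h'.scomp (0 : ℂ) h

lemma exists_norm_sub_le {η : ℝ} (hη : 0 < η) :
    ∃ δ > 0, ∀ z : ℂ, ‖z‖ < δ → ‖G.toFun z - (1 + z • G.gen)‖ ≤ η * ‖z‖ := by
  have h := (hasDerivAt_iff_isLittleO_nhds_zero.1 G.hasDerivAt).def hη
  obtain ⟨δ, hδ, h⟩ := Metric.eventually_nhds_iff.1 h
  refine ⟨δ, hδ, fun z hz => ?_⟩
  have := h (y := z) (by simpa using hz)
  rwa [zero_add, G.map_zero, sub_sub] at this

/-- The generator is dissipative in both directions: to first order in `r`, `1 + i r D` agrees with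
the isometry `exp (i r D)`, so the convex function `r ↦ ‖(1 + i r D) y‖` is minimal at `r = 0`. -/
lemma norm_le_norm_one_add (r : ℝ) (y : E) :
    ‖y‖ ≤ ‖(1 + ((r * Complex.I : ℂ)) • G.gen) y‖ := by
  set v := (r * Complex.I : ℂ) • G.gen y with hv
  have hgoal : (1 + ((r * Complex.I : ℂ)) • G.gen) y = y + v := by simp [hv]
  rw [hgoal]
  refine le_of_forall_pos_le_add fun η hη => ?_
  have hc : 0 < |r| * ‖y‖ + 1 := by positivity
  obtain ⟨δ, hδ, h⟩ := G.exists_norm_sub_le (div_pos hη hc)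
  -- A step `ε` so short that `exp (i ε r D)` is within `O(η ε)` of its linearization.
  set ε : ℝ := min 1 (δ / (2 * (|r| + 1))) with hε
  have hε0 : 0 < ε := lt_min one_pos (by positivity)
  have hε1 : ε ≤ 1 := min_le_left _ _
  have hz : ‖((ε * r : ℝ) : ℂ) * Complex.I‖ = ε * |r| := by
    rw [norm_mul, Complex.norm_I, mul_one, Complex.norm_real, norm_mul, Real.norm_eq_abs,
      Real.norm_eq_abs, abs_of_pos hε0]
  have hsmall : ε * |r| < δ := by
    have h1 : ε * (2 * (|r| + 1)) ≤ δ := by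
      rw [← le_div_iff₀ (by positivity)]
      exact min_le_right _ _
    nlinarith [abs_nonneg r]
  have h1 := h (((ε * r : ℝ) : ℂ) * Complex.I) (by rw [hz]; exact hsmall)
  rw [hz] at h1
  have h2 : ‖G.toFun (((ε * r : ℝ) : ℂ) * Complex.I) y - (y + (ε : ℂ) • v)‖ ≤
      η * ε := by
    have e : G.toFun (((ε * r : ℝ) : ℂ) * Complex.I) y - (y + (ε : ℂ) • v) =
        (G.toFun (((ε * r : ℝ) : ℂ) * Complex.I) -
          (1 + (((ε * r : ℝ) : ℂ) * Complex.I) • G.gen)) y := by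
      simp only [hv, sub_apply, add_apply, smul_apply,
        one_apply_eq_self, smul_smul]
      push_cast
      rw [mul_assoc]
    rw [e]
    refine (ContinuousLinearMap.le_of_opNorm_le _ h1 y).trans ?_
    rw [div_mul_eq_mul_div, div_mul_eq_mul_div, div_le_iff₀ hc]
    nlinarith [mul_pos hη hε0]
  -- Convexity of the norm along the ray from `y` in the direction `v`.
  have h3 : ‖y + (ε : ℂ) • v‖ ≤ (1 - ε) * ‖y‖ + ε * ‖y + v‖ := by
    have e : y + (ε : ℂ) • v = ((1 - ε : ℝ) : ℂ) • y + (ε : ℂ) • (y + v) := by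
      push_cast
      module
    rw [e]
    refine (norm_add_le _ _).trans_eq ?_
    rw [norm_smul, norm_smul, Complex.norm_real, Complex.norm_real,
      Real.norm_of_nonneg (by linarith), Real.norm_of_nonneg hε0.le]
  have h4 := norm_sub_norm_le (G.toFun (((ε * r : ℝ) : ℂ) * Complex.I) y) (y + (ε : ℂ) • v)
  rw [G.norm_map_I] at h4
  have h5 : ε * ‖y‖ ≤ ε * (‖y + v‖ + η) := by linarith
  exact le_of_mul_le_mul_left h5 hε0

lemma isUnit_one_add [CompleteSpace E] (r : ℝ) : IsUnit (1 + ((r * Complex.I : ℂ)) • G.gen) := by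
  refine isUnit_add_of_segment isUnit_one fun t _ _ y => ?_
  have := G.norm_le_norm_one_add (t * r) y
  rwa [Complex.ofReal_mul, mul_assoc, ← smul_smul] at this

lemma toFun_nsmul (n : ℕ) (z : ℂ) : G.toFun (n * z) = G.toFun z ^ n := by
  induction n with
  | zero => simp [G.map_zero]
  | succ n ih => rw [Nat.cast_succ, add_mul, one_mul, G.map_add, ih, pow_succ]

/-- Compares the `n`-th powers of `1 + D / n` and of `exp (D / n)`, which differ by `o(1 / n)`. -/
lemma tendsto_one_add_pow :
    Tendsto (fun n : ℕ => (1 + (n : ℂ)⁻¹ • G.gen) ^ n) atTop (𝓝 (G.toFun 1)) := by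
  rw [tendsto_iff_norm_sub_tendsto_zero]
  set c := ‖G.gen‖ + 1 with hc
  have hc0 : 0 < c := by positivity
  rw [Metric.tendsto_atTop]
  intro e he
  set η := min 1 (e / (2 * Real.exp c)) with hη
  have hη0 : 0 < η := lt_min one_pos (by positivity)
  obtain ⟨δ, hδ, h⟩ := G.exists_norm_sub_le hη0
  obtain ⟨n₀, hn₀⟩ := exists_nat_gt δ⁻¹
  refine ⟨n₀, fun n hn => ?_⟩
  have hn' : δ⁻¹ < (n : ℝ) := hn₀.trans_le (by exact_mod_cast hn)
  have hnpos : (0 : ℝ) < n := (inv_pos.2 hδ).trans hn'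
  have hnorm : ‖(n : ℂ)⁻¹‖ = (n : ℝ)⁻¹ := by simp
  have h1 := h (n : ℂ)⁻¹ (by rw [hnorm]; exact inv_lt_of_inv_lt₀ hδ hn')
  rw [hnorm] at h1
  have hy : ‖1 + (n : ℂ)⁻¹ • G.gen‖ ≤ 1 + ‖G.gen‖ * (n : ℝ)⁻¹ := by
    refine (norm_add_le _ _).trans (add_le_add ContinuousLinearMap.norm_one_le ?_)
    rw [norm_smul, hnorm, mul_comm]
  have hninv : 0 < (n : ℝ)⁻¹ := inv_pos.2 hnpos
  have hη1 : η ≤ 1 := min_le_left _ _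
  have hx : ‖G.toFun (n : ℂ)⁻¹‖ ≤ 1 + c * (n : ℝ)⁻¹ := by
    have := norm_sub_norm_le (G.toFun (n : ℂ)⁻¹) (1 + (n : ℂ)⁻¹ • G.gen)
    rw [hc]
    nlinarith
  have hG1 : G.toFun 1 = G.toFun (n : ℂ)⁻¹ ^ n := by
    rw [← G.toFun_nsmul, mul_inv_cancel₀]
    exact_mod_cast hnpos.ne'
  have hb := norm_pow_sub_pow_le (m := 1 + c * (n : ℝ)⁻¹)
    (le_add_of_nonneg_right (by positivity)) (hy.trans (by rw [hc]; nlinarith)) hx n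
  have hexp : (1 + c * (n : ℝ)⁻¹) ^ n ≤ Real.exp c := by
    calc (1 + c * (n : ℝ)⁻¹) ^ n ≤ Real.exp (c * (n : ℝ)⁻¹) ^ n := by
          gcongr
          rw [add_comm]
          exact Real.add_one_le_exp _
      _ = Real.exp c := by
          rw [← Real.exp_nat_mul]
          congr 1
          field_simp
  rw [dist_zero_right, norm_norm, hG1]
  rw [norm_sub_rev (1 + (n : ℂ)⁻¹ • G.gen)] at hb
  calc _ ≤ n * (1 + c * (n : ℝ)⁻¹) ^ n * ‖G.toFun (n : ℂ)⁻¹ - (1 + (n : ℂ)⁻¹ • G.gen)‖ := hb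
    _ ≤ n * Real.exp c * (η * (n : ℝ)⁻¹) := by gcongr
    _ = Real.exp c * η := by field_simp
    _ ≤ Real.exp c * (e / (2 * Real.exp c)) := by gcongr; exact min_le_right _ _
    _ = e / 2 := by field_simp
    _ < e := by linarith

/-- If `r` is purely imaginary, then `D - r = -r (1 + i s D)` with `s` real. -/
lemma sub_algebraMap_eq {r : ℂ} (hr : r.re = 0) (h0 : r ≠ 0) :
    G.gen - algebraMap ℂ (E →L[ℂ] E) r =
      (-r) • (1 + (((r.im)⁻¹ : ℝ) * Complex.I : ℂ) • G.gen) := by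
  have hr' : r = (r.im : ℂ) * Complex.I := by
    apply Complex.ext <;> simp [hr]
  have him : (r.im : ℂ) ≠ 0 := by
    intro h
    rw [h, zero_mul] at hr'
    exact h0 hr'
  have hm : -r * (((r.im)⁻¹ : ℝ) * Complex.I : ℂ) = 1 := by
    nth_rewrite 1 [hr']
    push_cast
    field_simp
    simp
  rw [smul_add, smul_smul, hm, one_smul, Algebra.algebraMap_eq_smul_one]
  module

/-- A polynomial with purely imaginary roots is a product of factors `D - r` as above. -/
lemma norm_eval_zero_mul_le_norm_aeval (p : ℂ[X]) (hp : ∀ r ∈ p.roots, r.re = 0) (y : E) :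
    ‖p.eval 0‖ * ‖y‖ ≤ ‖aeval G.gen p y‖ := by
  have key : ∀ s : Multiset ℂ, (∀ r ∈ s, r.re = 0) →
      ‖((s.map fun a => X - C a).prod).eval 0‖ * ‖y‖ ≤
        ‖aeval G.gen (s.map fun a => X - C a).prod y‖ := by
    intro s
    induction s using Multiset.induction with
    | empty => simp
    | cons r s ih =>
      intro hs
      have hr := hs r (Multiset.mem_cons_self r s)
      have ih := ih fun q hq => hs q (Multiset.mem_cons_of_mem hq)
      rw [Multiset.map_cons, Multiset.prod_cons, eval_mul, map_mul, norm_mul,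
        mul_apply_eq_comp]
      simp only [eval_sub, eval_X, eval_C, zero_sub, norm_neg, map_sub, aeval_X, aeval_C]
      rcases eq_or_ne r 0 with rfl | h0
      · simp
      rw [G.sub_algebraMap_eq hr h0, smul_apply, norm_smul, norm_neg, mul_assoc]
      gcongr
      exact ih.trans (G.norm_le_norm_one_add _ _)
  have e := (IsAlgClosed.splits p).eq_prod_roots
  have h := key p.roots hp
  rw [e, eval_mul, map_mul, norm_mul, mul_apply_eq_comp, eval_C, aeval_C,
    Algebra.algebraMap_eq_smul_one, smul_apply, norm_smul, mul_assoc,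
    one_apply_eq_self]
  gcongr

lemma isUnit_aeval [CompleteSpace E] (p : ℂ[X]) (hp : ∀ r ∈ p.roots, r.re = 0)
    (h0 : p.eval 0 ≠ 0) : IsUnit (aeval G.gen p) := by
  have key : ∀ s : Multiset ℂ, (∀ r ∈ s, r.re = 0 ∧ r ≠ 0) →
      IsUnit (aeval G.gen (s.map fun a => X - C a).prod) := by
    intro s
    induction s using Multiset.induction with
    | empty => simp
    | cons r s ih =>
      intro hs
      obtain ⟨hr, h0⟩ := hs r (Multiset.mem_cons_self r s)
      have ih := ih fun q hq => hs q (Multiset.mem_cons_of_mem hq)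
      rw [Multiset.map_cons, Multiset.prod_cons, map_mul]
      refine IsUnit.mul ?_ ih
      rw [map_sub, aeval_X, aeval_C, G.sub_algebraMap_eq hr h0]
      exact (G.isUnit_one_add _).smul (Units.mk0 (-r) (neg_ne_zero.2 h0))
  have hp0 : p ≠ 0 := by
    rintro rfl
    simp at h0
  rw [(IsAlgClosed.splits p).eq_prod_roots, map_mul, aeval_C]
  refine IsUnit.mul ?_ (key _ fun r hr => ⟨hp r hr, ?_⟩)
  · exact (isUnit_iff_ne_zero.2 (leadingCoeff_ne_zero.2 hp0)).map (algebraMap ℂ (E →L[ℂ] E))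
  · rintro rfl
    exact h0 ((mem_roots hp0).1 hr)

/-- The operator `cosh (s D)`. -/
noncomputable def cosh (s : ℝ) : E →L[ℂ] E :=
  (1 / 2 : ℂ) • (G.toFun s + G.toFun (-s))

/-- The polynomial `((1 + z / n) ^ n + (1 - z / n) ^ n) / 2`, an approximation of `cosh z`. -/
noncomputable def coshPoly (n : ℕ) : ℂ[X] :=
  C (1 / 2) * ((1 + C (n : ℂ)⁻¹ * X) ^ n + (1 - C (n : ℂ)⁻¹ * X) ^ n)

lemma coshPoly_eval_zero (n : ℕ) : (coshPoly n).eval 0 = 1 := by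
  simp [coshPoly]
  norm_num

/-- At a root `r` the numbers `1 + r / n` and `1 - r / n` have the same modulus. -/
lemma re_eq_zero_of_mem_roots_coshPoly {n : ℕ} (hn : n ≠ 0) {r : ℂ}
    (hr : r ∈ (coshPoly n).roots) : r.re = 0 := by
  have h : (coshPoly n).eval r = 0 := (mem_roots'.1 hr).2
  simp only [coshPoly, eval_mul, eval_C, eval_add, eval_pow, eval_one, eval_X, eval_sub] at h
  have h1 : (1 + (n : ℂ)⁻¹ * r) ^ n = -(1 - (n : ℂ)⁻¹ * r) ^ n := by
    linear_combination 2 * h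
  have h2 : ‖1 + (n : ℂ)⁻¹ * r‖ ^ n = ‖1 - (n : ℂ)⁻¹ * r‖ ^ n := by
    rw [← norm_pow, h1, norm_neg, norm_pow]
  have h3 := (pow_left_inj₀ (norm_nonneg _) (norm_nonneg _) hn).1 h2
  have h4 : Complex.normSq (1 + (n : ℂ)⁻¹ * r) = Complex.normSq (1 - (n : ℂ)⁻¹ * r) := by
    rw [Complex.normSq_eq_norm_sq, Complex.normSq_eq_norm_sq, h3]
  rw [Complex.normSq_apply, Complex.normSq_apply] at h4
  have h5 : ((n : ℂ)⁻¹ * r).re = 0 := by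
    simp only [Complex.add_re, Complex.sub_re, Complex.one_re, Complex.add_im, Complex.sub_im,
      Complex.one_im] at h4
    linarith
  have h6 : ((n : ℂ)⁻¹ * r).re = (n : ℝ)⁻¹ * r.re := by
    rw [← Complex.ofReal_natCast, ← Complex.ofReal_inv, Complex.re_ofReal_mul]
  rw [h6] at h5
  simpa [hn] using h5

lemma tendsto_aeval_coshPoly :
    Tendsto (fun n : ℕ => aeval G.gen (coshPoly n)) atTop (𝓝 (G.cosh 1)) := by
  have h1 := G.tendsto_one_add_pow
  have h2 := (G.scale (-1)).tendsto_one_add_pow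
  have h := (h1.add h2).const_smul (1 / 2 : ℂ)
  have e : G.cosh 1 = (1 / 2 : ℂ) • (G.toFun 1 + (G.scale (-1)).toFun 1) := by
    simp [cosh, scale]
  rw [e]
  refine h.congr fun n => ?_
  simp [coshPoly, scale, sub_eq_add_neg, ← Algebra.smul_def]

lemma norm_le_norm_cosh_one (y : E) : ‖y‖ ≤ ‖G.cosh 1 y‖ := by
  have h : Tendsto (fun n : ℕ => ‖aeval G.gen (coshPoly n) y‖) atTop (𝓝 ‖G.cosh 1 y‖) :=
    (((ContinuousLinearMap.apply ℂ E y).continuous.tendsto _).comp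
      G.tendsto_aeval_coshPoly).norm
  refine ge_of_tendsto h ((eventually_ne_atTop 0).mono fun n hn => ?_)
  simpa [coshPoly_eval_zero] using
    G.norm_eval_zero_mul_le_norm_aeval (coshPoly n)
      (fun r hr => re_eq_zero_of_mem_roots_coshPoly hn hr) y

lemma isUnit_cosh_one [CompleteSpace E] : IsUnit (G.cosh 1) := by
  have h := G.tendsto_aeval_coshPoly
  rw [tendsto_iff_norm_sub_tendsto_zero] at h
  obtain ⟨n, hn, hn0⟩ :=
    ((h.eventually (gt_mem_nhds one_pos)).and (eventually_ne_atTop 0)).exists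
  have hr : ∀ r ∈ (coshPoly n).roots, r.re = 0 :=
    fun r hr => re_eq_zero_of_mem_roots_coshPoly hn0 hr
  refine isUnit_of_norm_sub_lt_one (G.isUnit_aeval _ hr (by simp [coshPoly_eval_zero]))
    (fun y => ?_) (by rwa [norm_sub_rev] at hn)
  simpa [coshPoly_eval_zero] using G.norm_eval_zero_mul_le_norm_aeval (coshPoly n) hr y

lemma cosh_scale (s : ℝ) : (G.scale s).cosh 1 = G.cosh s := by
  simp [cosh, scale]

/-- The arithmetic-geometric mean inequality for a Hermitian generator. -/
lemma norm_le_norm_cosh (s : ℝ) (y : E) : ‖y‖ ≤ ‖G.cosh s y‖ := by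
  rw [← G.cosh_scale]
  exact (G.scale s).norm_le_norm_cosh_one y

lemma isUnit_cosh [CompleteSpace E] (s : ℝ) : IsUnit (G.cosh s) := by
  rw [← G.cosh_scale]
  exact (G.scale s).isUnit_cosh_one

lemma cosh_zero : G.cosh 0 = 1 := by
  simp only [cosh, Complex.ofReal_zero, neg_zero, G.map_zero]
  module

lemma cosh_neg (s : ℝ) : G.cosh (-s) = G.cosh s := by
  simp [cosh, add_comm]

lemma cosh_mul_cosh (s t : ℝ) :
    G.cosh s * G.cosh t = (1 / 2 : ℂ) • (G.cosh (s - t) + G.cosh (s + t)) := by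
  simp only [cosh, smul_mul_assoc, mul_smul_comm, add_mul, mul_add, ← G.map_add]
  push_cast
  have e1 : (-(s : ℂ) + -t) = -(s + t) := by ring
  have e2 : (-(s : ℂ) + t) = -(s - t) := by ring
  rw [e1, e2, ← sub_eq_add_neg]
  module

lemma half_cosh_add_apply (s t : ℝ) (y : E) :
    (1 / 2 : ℂ) • (G.cosh (s - t) y + G.cosh (s + t) y) = G.cosh t (G.cosh s y) := by
  have h := congrArg (· y) (G.cosh_mul_cosh t s)
  simp only [mul_apply_eq_comp, smul_apply, add_apply] at h
  rw [h, ← G.cosh_neg (t - s), neg_sub, add_comm t s]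

lemma continuous_toFun : Continuous G.toFun := by
  rw [continuous_iff_continuousAt]
  intro z
  have h : G.toFun = fun w => G.toFun z * G.toFun (w - z) := by
    funext w
    rw [← G.map_add, add_sub_cancel]
  rw [h]
  have h0 : ContinuousAt G.toFun (z - z) := by
    rw [sub_self]
    exact G.hasDerivAt.continuousAt
  have h1 : ContinuousAt (fun w : ℂ => G.toFun (w - z)) z :=
    ContinuousAt.comp (f := fun w : ℂ => w - z) h0 (by fun_prop)
  exact continuousAt_const.mul h1

lemma continuous_norm_cosh_apply (y : E) : Continuous fun s : ℝ => ‖G.cosh s y‖ := by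
  have := G.continuous_toFun
  unfold cosh
  fun_prop

/-- Heinz monotonicity.  The function `s ↦ ‖cosh (s D) y‖` is even, continuous and midpoint convex,
hence its maximum over `[-t, t]` is attained at `t`: a maximum point `r ≥ 0` is the midpoint of `t`
and `2 r - t`. -/
lemma norm_cosh_le_norm_cosh {s t : ℝ} (h : |s| ≤ t) (y : E) : ‖G.cosh s y‖ ≤ ‖G.cosh t y‖ := by
  have ht : 0 ≤ t := (abs_nonneg s).trans h
  obtain ⟨r, ⟨hr0, hrt⟩, hr⟩ := (isCompact_Icc (a := -t) (b := t)).exists_isMaxOn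
    ⟨0, by simpa using ht⟩ (G.continuous_norm_cosh_apply y).continuousOn
  have key : ∀ r : ℝ, 0 ≤ r → r ≤ t → (∀ q, -t ≤ q → q ≤ t → ‖G.cosh q y‖ ≤ ‖G.cosh r y‖) →
      ‖G.cosh r y‖ ≤ ‖G.cosh t y‖ := by
    intro r h0 h1 hmax
    have h2 := G.norm_le_norm_cosh (t - r) (G.cosh r y)
    rw [← G.half_cosh_add_apply, add_sub_cancel, norm_smul] at h2
    have h3 := norm_add_le (G.cosh (r - (t - r)) y) (G.cosh t y)
    have h4 := hmax (r - (t - r)) (by linarith) (by linarith)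
    norm_num at h2
    linarith
  have hmax : ∀ q, -t ≤ q → q ≤ t → ‖G.cosh q y‖ ≤ ‖G.cosh r y‖ := fun q h1 h2 => hr ⟨h1, h2⟩
  refine (hmax s (abs_le.1 h).1 (abs_le.1 h).2).trans ?_
  rcases le_total 0 r with h0 | h0
  · exact key r h0 hrt hmax
  · rw [← G.cosh_neg r] at hmax ⊢
    exact key (-r) (by linarith) (by linarith) hmax

/-- The operator `(1 - γ) + γ cosh (s D)`. -/
noncomputable def heron (γ s : ℝ) : E →L[ℂ] E :=
  ((1 - γ : ℝ) : ℂ) • 1 + (γ : ℂ) • G.cosh s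

/-- The operator `(1 - γ) cosh (s D) + γ cosh (2 s D)`. -/
noncomputable def heinzCombo (γ s : ℝ) : E →L[ℂ] E :=
  ((1 - γ : ℝ) : ℂ) • G.cosh s + (γ : ℂ) • G.cosh (2 * s)

lemma half_one_add_cosh (s : ℝ) (y : E) :
    (1 / 2 : ℂ) • (y + G.cosh s y) = G.cosh (s / 2) (G.cosh (s / 2) y) := by
  rw [← G.half_cosh_add_apply, sub_self, add_halves, G.cosh_zero, one_apply_eq_self]

lemma half_cosh_add_cosh (s : ℝ) (y : E) :
    (1 / 2 : ℂ) • (G.cosh s y + G.cosh (2 * s) y) = G.cosh (s / 2) (G.cosh (3 * s / 2) y) := by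
  rw [← G.half_cosh_add_apply]
  ring_nf

lemma norm_cosh_half_le_norm_heron {γ : ℝ} (hγ : 1 / 2 ≤ γ) (s : ℝ) (y : E) :
    ‖G.cosh (s / 2) y‖ ≤ ‖G.heron γ s y‖ := by
  refine (G.norm_le_norm_cosh (s / 2) _).trans ?_
  rw [← G.half_one_add_cosh]
  refine (norm_half_add_le_norm_combo ?_ hγ).trans_eq ?_
  · rw [G.half_one_add_cosh]
    exact (G.norm_le_norm_cosh _ _).trans (G.norm_le_norm_cosh _ _)
  · simp [heron]

lemma norm_heron_le_norm_cosh {γ : ℝ} (h0 : 0 ≤ γ) (h1 : γ ≤ 1) (s : ℝ) (y : E) :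
    ‖G.heron γ s y‖ ≤ ‖G.cosh s y‖ := by
  have := norm_combo_le (G.norm_le_norm_cosh s y) h0 h1
  simpa [heron] using this

lemma norm_cosh_le_half_cosh_add_cosh {s : ℝ} (hs : 0 ≤ s) (y : E) :
    ‖G.cosh s y‖ ≤ ‖(1 / 2 : ℂ) • (G.cosh s y + G.cosh (2 * s) y)‖ := by
  rw [G.half_cosh_add_cosh]
  refine (G.norm_cosh_le_norm_cosh (t := 3 * s / 2) ?_ y).trans (G.norm_le_norm_cosh _ _)
  rw [abs_of_nonneg hs]
  linarith

lemma norm_cosh_le_norm_heinzCombo {γ : ℝ} (hγ : 1 / 2 ≤ γ) {s : ℝ} (hs : 0 ≤ s) (y : E) :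
    ‖G.cosh (3 * s / 2) y‖ ≤ ‖G.heinzCombo γ s y‖ := by
  refine (G.norm_le_norm_cosh (s / 2) _).trans ?_
  rw [← G.half_cosh_add_cosh]
  exact norm_half_add_le_norm_combo (G.norm_cosh_le_half_cosh_add_cosh hs y) hγ

lemma norm_heinzCombo_le_norm_cosh {γ : ℝ} (h0 : 0 ≤ γ) (h1 : γ ≤ 1) {s : ℝ} (hs : 0 ≤ s)
    (y : E) : ‖G.heinzCombo γ s y‖ ≤ ‖G.cosh (2 * s) y‖ := by
  refine norm_combo_le (G.norm_cosh_le_norm_cosh ?_ y) h0 h1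
  rw [abs_of_nonneg hs]
  linarith

lemma isUnit_heron [CompleteSpace E] {γ : ℝ} (hγ : 1 / 2 ≤ γ) (s : ℝ) : IsUnit (G.heron γ s) := by
  have h : ∀ y : E, ‖y‖ ≤ ‖(1 / 2 : ℂ) • ((1 : E →L[ℂ] E) y + G.cosh s y)‖ := fun y => by
    rw [one_apply_eq_self, G.half_one_add_cosh]
    exact (G.norm_le_norm_cosh _ _).trans (G.norm_le_norm_cosh _ _)
  refine isUnit_combo h h ?_ hγ
  have e : (1 / 2 : ℂ) • (1 + G.cosh s) = G.cosh (s / 2) * G.cosh (s / 2) := by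
    rw [G.cosh_mul_cosh, sub_self, add_halves, G.cosh_zero]
  rw [e]
  exact (G.isUnit_cosh _).mul (G.isUnit_cosh _)

lemma isUnit_heinzCombo [CompleteSpace E] {γ : ℝ} (hγ : 1 / 2 ≤ γ) {s : ℝ} (hs : 0 ≤ s) :
    IsUnit (G.heinzCombo γ s) := by
  refine isUnit_combo (G.norm_cosh_le_half_cosh_add_cosh hs)
    (fun y => (G.norm_le_norm_cosh s y).trans (G.norm_cosh_le_half_cosh_add_cosh hs y)) ?_ hγ
  have e : (1 / 2 : ℂ) • (G.cosh s + G.cosh (2 * s)) = G.cosh (3 * s / 2) * G.cosh (s / 2) := by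
    rw [G.cosh_mul_cosh]
    ring_nf
  rw [e]
  exact (G.isUnit_cosh _).mul (G.isUnit_cosh _)

end HermitianGroup

end HermitianGenerators

/-! ### The ideal of operators of finite norm -/

namespace UnitarilyInvariantNorm

variable {H : Type*} [NormedAddCommGroup H] [InnerProductSpace ℂ H] [CompleteSpace H]
  (N : UnitarilyInvariantNorm H)

lemma apply_zero : N 0 = 0 := by
  simpa using N.smul' 0 0

lemma apply_sum_le {ι : Type*} (s : Finset ι) (f : ι → (H →L[ℂ] H)) :
    N (∑ i ∈ s, f i) ≤ ∑ i ∈ s, N (f i) :=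
  Finset.le_sum_of_subadditive N N.apply_zero.le N.add_le' s f

/-- Follows by writing `S` as a linear combination of four unitaries. -/
lemma apply_mul_le (S T : H →L[ℂ] H) : N (S * T) ≤ ENNReal.ofReal (2 * ‖S‖) * N T := by
  obtain ⟨u, c, hS, hc⟩ := CStarAlgebra.exists_sum_four_unitary S
  have e : S * T = ∑ i, c i • ((u i : H →L[ℂ] H) * T) := by
    conv_lhs => rw [hS]
    simp only [Finset.sum_mul, smul_mul_assoc]
  have hu : ∀ i, N ((u i : H →L[ℂ] H) * T) = N T := fun i => by
    simpa using N.unitary_mul_mul' _ (u i).2 1 (one_mem _) T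
  rw [e]
  calc _ ≤ ∑ i, N (c i • ((u i : H →L[ℂ] H) * T)) := N.apply_sum_le _ _
    _ ≤ ∑ _i : Fin 4, ENNReal.ofReal (‖S‖ / 2) * N T := by
        refine Finset.sum_le_sum fun i _ => ?_
        rw [N.smul', hu, ← ofReal_norm]
        gcongr
        exact hc i
    _ = _ := by
        rw [Finset.sum_const, Finset.card_univ, Fintype.card_fin, nsmul_eq_mul, ← mul_assoc,
          ← ENNReal.ofReal_natCast, ← ENNReal.ofReal_mul (by positivity)]
        congr 2
        push_cast
        ring

lemma mul_apply_le (S T : H →L[ℂ] H) : N (T * S) ≤ ENNReal.ofReal (2 * ‖S‖) * N T := by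
  obtain ⟨u, c, hS, hc⟩ := CStarAlgebra.exists_sum_four_unitary S
  have e : T * S = ∑ i, c i • (T * (u i : H →L[ℂ] H)) := by
    conv_lhs => rw [hS]
    simp only [Finset.mul_sum, mul_smul_comm]
  have hu : ∀ i, N (T * (u i : H →L[ℂ] H)) = N T := fun i => by
    simpa using N.unitary_mul_mul' 1 (one_mem _) _ (u i).2 T
  rw [e]
  calc _ ≤ ∑ i, N (c i • (T * (u i : H →L[ℂ] H))) := N.apply_sum_le _ _
    _ ≤ ∑ _i : Fin 4, ENNReal.ofReal (‖S‖ / 2) * N T := by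
        refine Finset.sum_le_sum fun i _ => ?_
        rw [N.smul', hu, ← ofReal_norm]
        gcongr
        exact hc i
    _ = _ := by
        rw [Finset.sum_const, Finset.card_univ, Fintype.card_fin, nsmul_eq_mul, ← mul_assoc,
          ← ENNReal.ofReal_natCast, ← ENNReal.ofReal_mul (by positivity)]
        congr 2
        push_cast
        ring

lemma mul_lt_top (S : H →L[ℂ] H) {T : H →L[ℂ] H} (hT : N T < ∞) : N (S * T) < ∞ :=
  (N.apply_mul_le S T).trans_lt (ENNReal.mul_lt_top ENNReal.ofReal_lt_top hT)

lemma lt_top_mul (S : H →L[ℂ] H) {T : H →L[ℂ] H} (hT : N T < ∞) : N (T * S) < ∞ :=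
  (N.mul_apply_le S T).trans_lt (ENNReal.mul_lt_top ENNReal.ofReal_lt_top hT)

/-- The linear subspace `{T | |||T||| < ∞}`. -/
def finiteSubmodule : Submodule ℂ (H →L[ℂ] H) where
  carrier := {T | N T < ∞}
  add_mem' hS hT := (N.add_le' _ _).trans_lt (ENNReal.add_lt_top.2 ⟨hS, hT⟩)
  zero_mem' := by simp [N.apply_zero]
  smul_mem' c T hT := by
    rw [Set.mem_ofPred_eq, N.smul']
    exact ENNReal.mul_lt_top enorm_lt_top hT

/-- The ideal `{T | |||T||| < ∞}` as a normed space with the norm `|||·|||`.  It is a type synonym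
of `finiteSubmodule`, which already carries the operator norm. -/
def FiniteIdeal : Type _ := N.finiteSubmodule

namespace FiniteIdeal

instance : AddCommGroup N.FiniteIdeal := inferInstanceAs (AddCommGroup N.finiteSubmodule)

instance : Module ℂ N.FiniteIdeal := inferInstanceAs (Module ℂ N.finiteSubmodule)

/-- The inclusion of the ideal into the bounded operators. -/
def incl : N.FiniteIdeal →ₗ[ℂ] (H →L[ℂ] H) := N.finiteSubmodule.subtype

variable {N}

/-- An operator of finite norm as an element of the ideal. -/
def ofFinite (T : H →L[ℂ] H) (hT : N T < ∞) : N.FiniteIdeal := ⟨T, hT⟩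

@[simp] lemma incl_ofFinite (T : H →L[ℂ] H) (hT : N T < ∞) : incl N (ofFinite T hT) = T := rfl

lemma incl_lt_top (T : N.FiniteIdeal) : N (incl N T) < ∞ := T.2

lemma incl_injective : Function.Injective (incl N) := Subtype.val_injective

instance : Norm N.FiniteIdeal := ⟨fun T => (N (incl N T)).toReal⟩

lemma norm_def (T : N.FiniteIdeal) : ‖T‖ = (N (incl N T)).toReal := rfl

lemma ofReal_norm_eq (T : N.FiniteIdeal) : ENNReal.ofReal ‖T‖ = N (incl N T) :=
  ENNReal.ofReal_toReal (incl_lt_top T).ne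

lemma core : NormedSpace.Core ℂ N.FiniteIdeal where
  norm_nonneg T := ENNReal.toReal_nonneg
  norm_smul c T := by
    rw [norm_def, norm_def, map_smul, N.smul', ENNReal.toReal_mul, toReal_enorm]
  norm_triangle S T := by
    rw [norm_def, norm_def, norm_def, map_add,
      ← ENNReal.toReal_add (incl_lt_top S).ne (incl_lt_top T).ne]
    exact ENNReal.toReal_mono
      (ENNReal.add_ne_top.2 ⟨(incl_lt_top S).ne, (incl_lt_top T).ne⟩) (N.add_le' _ _)
  norm_eq_zero_iff T := by
    rw [norm_def, ENNReal.toReal_eq_zero_iff, or_iff_left (incl_lt_top T).ne]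
    constructor
    · intro h
      exact incl_injective ((N.eq_zero' _ h).trans (map_zero _).symm)
    · rintro rfl
      rw [map_zero, N.apply_zero]

noncomputable instance : NormedAddCommGroup N.FiniteIdeal := NormedAddCommGroup.ofCore core

noncomputable instance : NormedSpace ℂ N.FiniteIdeal := NormedSpace.ofCore core

lemma norm_le_norm_iff {S T : N.FiniteIdeal} : ‖S‖ ≤ ‖T‖ ↔ N (incl N S) ≤ N (incl N T) := by
  rw [norm_def, norm_def, ENNReal.toReal_le_toReal (incl_lt_top S).ne (incl_lt_top T).ne]

lemma completeSpace (hN : N.IsComplete) : CompleteSpace N.FiniteIdeal := by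
  refine Metric.complete_of_cauchySeq_tendsto fun u hu => ?_
  have hlt : ∀ (x : N.FiniteIdeal) (ε : ℝ≥0∞) (r : ℝ), ENNReal.ofReal r ≤ ε → ‖x‖ < r →
      N (incl N x) < ε := fun x ε r hr hx => by
    rw [← ofReal_norm_eq]
    exact ((ENNReal.ofReal_lt_ofReal_iff ((norm_nonneg x).trans_lt hx)).2 hx).trans_le hr
  obtain ⟨L, hL, h⟩ := hN (fun n => incl N (u n)) (fun n => incl_lt_top (u n)) fun ε hε => by
    obtain ⟨r, hr0, hr⟩ := ENNReal.lt_iff_exists_real_btwn.1 hε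
    obtain ⟨n₀, h⟩ := Metric.cauchySeq_iff.1 hu r (by simpa using hr.1)
    refine ⟨n₀, fun m hm n hn => ?_⟩
    rw [← map_sub]
    exact hlt _ _ r hr.2.le (by simpa [dist_eq_norm] using h m hm n hn)
  refine ⟨ofFinite L hL, Metric.tendsto_atTop.2 fun ε hε => ?_⟩
  obtain ⟨n₀, h⟩ := h (ENNReal.ofReal ε) (by simpa using hε)
  refine ⟨n₀, fun n hn => ?_⟩
  have h1 := h n hn
  rwa [← incl_ofFinite (N := N) L hL, ← map_sub, ← ofReal_norm_eq, ENNReal.ofReal_lt_ofReal_iff hε,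
    ← dist_eq_norm] at h1

/-- Left multiplication on the ideal, as a bounded operator depending boundedly on the factor. -/
noncomputable def left : (H →L[ℂ] H) →L[ℂ] N.FiniteIdeal →L[ℂ] N.FiniteIdeal :=
  LinearMap.mkContinuous₂
    (LinearMap.mk₂ ℂ (fun S T => ofFinite (S * incl N T) (N.mul_lt_top S (incl_lt_top T)))
      (fun S S' T => incl_injective (by simp [add_mul]))
      (fun c S T => incl_injective (by simp))
      (fun S T T' => incl_injective (by simp [mul_add]))
      (fun c S T => incl_injective (by simp)))
    2 fun S T => by
      rw [LinearMap.mk₂_apply, norm_def, norm_def, incl_ofFinite,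
        ← ENNReal.toReal_ofReal (show 0 ≤ 2 * ‖S‖ by positivity), ← ENNReal.toReal_mul]
      exact ENNReal.toReal_mono
        (ENNReal.mul_ne_top ENNReal.ofReal_ne_top (incl_lt_top T).ne) (N.apply_mul_le S _)

/-- Right multiplication on the ideal. -/
noncomputable def right : (H →L[ℂ] H) →L[ℂ] N.FiniteIdeal →L[ℂ] N.FiniteIdeal :=
  LinearMap.mkContinuous₂
    (LinearMap.mk₂ ℂ (fun S T => ofFinite (incl N T * S) (N.lt_top_mul S (incl_lt_top T)))
      (fun S S' T => incl_injective (by simp [mul_add]))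
      (fun c S T => incl_injective (by simp))
      (fun S T T' => incl_injective (by simp [add_mul]))
      (fun c S T => incl_injective (by simp)))
    2 fun S T => by
      rw [LinearMap.mk₂_apply, norm_def, norm_def, incl_ofFinite,
        ← ENNReal.toReal_ofReal (show 0 ≤ 2 * ‖S‖ by positivity), ← ENNReal.toReal_mul]
      exact ENNReal.toReal_mono
        (ENNReal.mul_ne_top ENNReal.ofReal_ne_top (incl_lt_top T).ne) (N.mul_apply_le S _)

@[simp] lemma incl_left (S : H →L[ℂ] H) (T : N.FiniteIdeal) :
    incl N (left S T) = S * incl N T := rfl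

@[simp] lemma incl_right (S : H →L[ℂ] H) (T : N.FiniteIdeal) :
    incl N (right S T) = incl N T * S := rfl

lemma left_one : left (N := N) 1 = 1 := by
  ext T
  apply incl_injective
  rw [incl_left, one_mul, one_apply_eq_self]

lemma right_one : right (N := N) 1 = 1 := by
  ext T
  apply incl_injective
  rw [incl_right, mul_one, one_apply_eq_self]

end FiniteIdeal

/-- The operator norm. -/
noncomputable def opNorm (H : Type*) [NormedAddCommGroup H] [InnerProductSpace ℂ H]
    [CompleteSpace H] : UnitarilyInvariantNorm H where
  toFun T := ‖T‖ₑ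
  eq_zero' T := enorm_eq_zero.1
  add_le' := enorm_add_le
  smul' c T := enorm_smul c T
  unitary_mul_mul' U hU V hV T := by
    rw [← ofReal_norm, ← ofReal_norm,
      CStarRing.norm_mul_mem_unitary _ hV, CStarRing.norm_mem_unitary_mul _ hU]

lemma opNorm_lt_top (T : H →L[ℂ] H) : opNorm H T < ∞ := enorm_lt_top (x := T)

end UnitarilyInvariantNorm

/-! ### Powers of a positive operator as exponentials -/

section Exponential

variable {H : Type*} [NormedAddCommGroup H] [InnerProductSpace ℂ H] [CompleteSpace H]

open NormedSpace

lemma exp_smul_add (a : H →L[ℂ] H) (z w : ℂ) :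
    exp ((z + w) • a) = exp (z • a) * exp (w • a) := by
  let +nondep : NormedAlgebra ℚ (H →L[ℂ] H) := .restrictScalars ℚ ℂ _
  rw [add_smul]
  exact exp_add_of_commute (((Commute.refl a).smul_left z).smul_right w)

lemma hasDerivAt_exp_smul_zero (a : H →L[ℂ] H) :
    HasDerivAt (fun z : ℂ => exp (z • a)) a 0 := by
  simpa using hasDerivAt_exp_smul_const a (0 : ℂ)

lemma hasDerivAt_mul_exp_smul_zero {E : Type*} [NormedAddCommGroup E] [NormedSpace ℂ E]
    (l r : (H →L[ℂ] H) →L[ℂ] E →L[ℂ] E) (hl : l 1 = 1) (hr : r 1 = 1) (a b : H →L[ℂ] H) :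
    HasDerivAt (fun z : ℂ => l (exp (z • a)) * r (exp (z • b))) (l a + r b) 0 := by
  have h1 : HasDerivAt (fun z : ℂ => l (exp (z • a))) (l a) 0 :=
    l.hasFDerivAt.comp_hasDerivAt (0 : ℂ) (hasDerivAt_exp_smul_zero a)
  have h2 : HasDerivAt (fun z : ℂ => r (exp (z • b))) (r b) 0 :=
    r.hasFDerivAt.comp_hasDerivAt (0 : ℂ) (hasDerivAt_exp_smul_zero b)
  have h := h1.mul h2
  rwa [zero_smul, zero_smul, exp_zero, hl, hr, mul_one, one_mul] at h

lemma exp_smul_mem_unitary {a : H →L[ℂ] H} (ha : IsSelfAdjoint a) (t : ℝ) :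
    exp (((t : ℂ) * Complex.I) • a) ∈ unitary (H →L[ℂ] H) := by
  have h : IsSelfAdjoint ((t : ℝ) • a) := (IsSelfAdjoint.all t).smul ha
  have e : ((t : ℂ) * Complex.I) • a = Complex.I • (t • a) := by
    rw [← Complex.coe_smul, smul_smul, mul_comm]
  rw [e]
  exact (selfAdjoint.expUnitary ⟨t • a, h⟩).2

lemma exp_smul_log {A : H →L[ℂ] H} (hA : IsStrictlyPositive A) (s : ℝ) :
    exp ((s : ℂ) • CFC.log A) = A ^ s := by
  have hA0 : 0 ≤ A := hA.nonneg
  have hpos : ∀ x ∈ spectrum ℝ A, 0 < x := fun x hx => hA.spectrum_pos hx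
  have hcont : ContinuousOn Real.log (spectrum ℝ A) := by
    intro x hx
    exact (Real.continuousAt_log (hpos x hx).ne').continuousWithinAt
  have hsa : IsSelfAdjoint A := hA0.isSelfAdjoint
  rw [Complex.coe_smul, CFC.log, ← cfc_smul s Real.log A hcont,
    ← CFC.real_exp_eq_normedSpace_exp (cfc_predicate _ A),
    ← cfc_comp' Real.exp (fun x => s • Real.log x) A (by fun_prop) (by fun_prop),
    CFC.rpow_eq_cfc_real]
  refine cfc_congr fun x hx => ?_
  rw [Real.rpow_def_of_pos (hpos x hx), smul_eq_mul, mul_comm]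

end Exponential

/-! ### Conjugation by powers of two positive operators -/

namespace UnitarilyInvariantNorm

variable {H : Type*} [NormedAddCommGroup H] [InnerProductSpace ℂ H] [CompleteSpace H]
  (N : UnitarilyInvariantNorm H) {A B : H →L[ℂ] H}

open NormedSpace FiniteIdeal

/-- The map `T ↦ (A ^ s T B ^ (-s) + A ^ (-s) T B ^ s) / 2`, that is `cosh (s D)` for
`D T = (log A) T - T (log B)`. -/
noncomputable def coshConj (A B : H →L[ℂ] H) (s : ℝ) (T : H →L[ℂ] H) : H →L[ℂ] H :=
  (1 / 2 : ℝ) • (A ^ s * T * B ^ (-s) + A ^ (-s) * T * B ^ s)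

/-- The group `T ↦ A ^ z T B ^ (-z)` on the ideal. -/
noncomputable def conjGroup (A B : H →L[ℂ] H) : HermitianGroup N.FiniteIdeal where
  toFun z := left (exp (z • CFC.log A)) * right (exp (z • -CFC.log B))
  gen := left (CFC.log A) + right (-CFC.log B)
  map_zero := by
    rw [zero_smul, zero_smul, exp_zero, left_one, right_one, one_mul]
  map_add z w := by
    ext T
    apply incl_injective
    rw [exp_smul_add, add_comm z w, exp_smul_add]
    simp only [mul_apply_eq_comp, incl_left, incl_right, mul_assoc]
  norm_map_I t T := by
    have ha : IsSelfAdjoint (CFC.log A) := IsSelfAdjoint.log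
    have hb : IsSelfAdjoint (-CFC.log B) := IsSelfAdjoint.neg IsSelfAdjoint.log
    rw [mul_apply_eq_comp, norm_def, norm_def, incl_left, incl_right, ← mul_assoc,
      N.unitary_mul_mul' _ (exp_smul_mem_unitary ha t) _ (exp_smul_mem_unitary hb t)]
  hasDerivAt := hasDerivAt_mul_exp_smul_zero left right left_one right_one _ _

lemma incl_conjGroup (hA : IsStrictlyPositive A) (hB : IsStrictlyPositive B) (s : ℝ)
    (T : N.FiniteIdeal) :
    incl N ((N.conjGroup A B).toFun s T) = A ^ s * incl N T * B ^ (-s) := by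
  simp only [conjGroup, mul_apply_eq_comp, incl_left, incl_right, smul_neg]
  rw [← neg_smul, ← Complex.ofReal_neg, exp_smul_log hA, exp_smul_log hB, mul_assoc]

lemma incl_cosh (hA : IsStrictlyPositive A) (hB : IsStrictlyPositive B) (s : ℝ)
    (T : N.FiniteIdeal) :
    incl N ((N.conjGroup A B).cosh s T) = coshConj A B s (incl N T) := by
  rw [coshConj, HermitianGroup.cosh, smul_apply, add_apply, map_smul, map_add, ← Complex.ofReal_neg,
    N.incl_conjGroup hA hB, N.incl_conjGroup hA hB, neg_neg, ← Complex.coe_smul]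
  norm_num

lemma incl_heron (hA : IsStrictlyPositive A) (hB : IsStrictlyPositive B) (γ s : ℝ)
    (T : N.FiniteIdeal) :
    incl N ((N.conjGroup A B).heron γ s T) =
      (1 - γ) • incl N T + γ • coshConj A B s (incl N T) := by
  rw [HermitianGroup.heron, add_apply, smul_apply, smul_apply, one_apply_eq_self, map_add,
    map_smul, map_smul, N.incl_cosh hA hB, Complex.coe_smul, Complex.coe_smul]

lemma incl_heinzCombo (hA : IsStrictlyPositive A) (hB : IsStrictlyPositive B) (γ s : ℝ)
    (T : N.FiniteIdeal) :
    incl N ((N.conjGroup A B).heinzCombo γ s T) =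
      (1 - γ) • coshConj A B s (incl N T) + γ • coshConj A B (2 * s) (incl N T) := by
  rw [HermitianGroup.heinzCombo, add_apply, smul_apply, smul_apply, map_add, map_smul, map_smul,
    N.incl_cosh hA hB, N.incl_cosh hA hB, Complex.coe_smul, Complex.coe_smul]

lemma coshConj_neg (A B : H →L[ℂ] H) (s : ℝ) (T : H →L[ℂ] H) :
    coshConj A B (-s) T = coshConj A B s T := by
  rw [coshConj, coshConj, neg_neg, add_comm]

variable {N}

/-- If a map on the bounded operators restricts to an invertible map of the ideal and does not
decrease the operator norm, then the preimage of the ideal is the ideal. -/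
lemma lt_top_of_apply_lt_top {Φ : (H →L[ℂ] H) → (H →L[ℂ] H)}
    {φ : N.FiniteIdeal →L[ℂ] N.FiniteIdeal}
    {ψ : (opNorm H).FiniteIdeal →L[ℂ] (opNorm H).FiniteIdeal}
    (hφ : ∀ T, incl N (φ T) = Φ (incl N T))
    (hψ : ∀ T, incl (opNorm H) (ψ T) = Φ (incl (opNorm H) T))
    (hu : IsUnit φ) (hb : ∀ T, ‖T‖ ≤ ‖ψ T‖) {Y : H →L[ℂ] H} (hY : N (Φ Y) < ∞) : N Y < ∞ := by
  obtain ⟨u, rfl⟩ := hu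
  set W := ((u⁻¹ : (N.FiniteIdeal →L[ℂ] N.FiniteIdeal)ˣ) :
    N.FiniteIdeal →L[ℂ] N.FiniteIdeal) (ofFinite (Φ Y) hY) with hWdef
  have hW : Φ (incl N W) = Φ Y := by
    rw [← hφ, hWdef, ← mul_apply_eq_comp, Units.mul_inv, one_apply_eq_self, incl_ofFinite]
  have h0 : ψ (ofFinite Y (opNorm_lt_top Y) - ofFinite (incl N W) (opNorm_lt_top _)) = 0 := by
    apply incl_injective
    rw [map_sub, map_sub, hψ, hψ, incl_ofFinite, incl_ofFinite, hW, sub_self, map_zero]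
  have h1 := hb (ofFinite Y (opNorm_lt_top Y) - ofFinite (incl N W) (opNorm_lt_top _))
  rw [h0, norm_zero, norm_le_zero_iff, sub_eq_zero] at h1
  have h2 := congrArg (incl (opNorm H)) h1
  rw [incl_ofFinite, incl_ofFinite] at h2
  rw [h2]
  exact incl_lt_top W

lemma lt_top_of_heron_lt_top (hN : N.IsComplete) (hA : IsStrictlyPositive A)
    (hB : IsStrictlyPositive B) {γ : ℝ} (hγ : 1 / 2 ≤ γ) (s : ℝ) {Y : H →L[ℂ] H}
    (hY : N ((1 - γ) • Y + γ • coshConj A B s Y) < ∞) : N Y < ∞ := by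
  have := completeSpace hN
  exact lt_top_of_apply_lt_top (Φ := fun Y => (1 - γ) • Y + γ • coshConj A B s Y)
    (N.incl_heron hA hB γ s) ((opNorm H).incl_heron hA hB γ s)
    (HermitianGroup.isUnit_heron _ hγ s)
    (fun T => (HermitianGroup.norm_le_norm_cosh _ _ T).trans
      (HermitianGroup.norm_cosh_half_le_norm_heron _ hγ s T)) hY

lemma lt_top_of_heinzCombo_lt_top (hN : N.IsComplete) (hA : IsStrictlyPositive A)
    (hB : IsStrictlyPositive B) {γ : ℝ} (hγ : 1 / 2 ≤ γ) {s : ℝ} (hs : 0 ≤ s) {Y : H →L[ℂ] H}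
    (hY : N ((1 - γ) • coshConj A B s Y + γ • coshConj A B (2 * s) Y) < ∞) : N Y < ∞ := by
  have := completeSpace hN
  exact lt_top_of_apply_lt_top
    (Φ := fun Y => (1 - γ) • coshConj A B s Y + γ • coshConj A B (2 * s) Y)
    (N.incl_heinzCombo hA hB γ s) ((opNorm H).incl_heinzCombo hA hB γ s)
    (HermitianGroup.isUnit_heinzCombo _ hγ hs)
    (fun T => (HermitianGroup.norm_le_norm_cosh _ _ T).trans
      (HermitianGroup.norm_cosh_le_norm_heinzCombo _ hγ hs T)) hY

/-- An inequality between the norms of two images of `Y` holds as soon as it holds for `Y` in the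
ideal, provided that the right-hand side is infinite outside the ideal. -/
lemma le_of_finite_of_complete {Y S T : H →L[ℂ] H} (hY : N Y < ∞ ∨ N.IsComplete)
    (hT : N.IsComplete → N T < ∞ → N Y < ∞) (h : N Y < ∞ → N S ≤ N T) : N S ≤ N T := by
  rcases hY with hY | hN
  · exact h hY
  · rcases lt_or_ge (N T) ∞ with hlt | hge
    · exact h (hT hN hlt)
    · exact le_top.trans hge

end UnitarilyInvariantNorm

/-! ### The means as hyperbolic cosines -/

section Means

open UnitarilyInvariantNorm

variable {H : Type*} [NormedAddCommGroup H] [InnerProductSpace ℂ H] [CompleteSpace H]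
  {A B : H →L[ℂ] H}

lemma rpow_mul_rpow_mul_mul (hA : IsStrictlyPositive A) (hB : IsStrictlyPositive B) (s : ℝ)
    (X : H →L[ℂ] H) :
    A ^ s * (A ^ (1 / 2 : ℝ) * X * B ^ (1 / 2 : ℝ)) * B ^ (-s) =
      A ^ (1 / 2 + s) * X * B ^ (1 / 2 - s) := by
  rw [add_comm, CFC.rpow_add hA.isUnit, sub_eq_add_neg, CFC.rpow_add hB.isUnit]
  simp only [mul_assoc]

/-- The Heinz mean as `cosh ((ν - 1/2) D)` applied to `A^(1/2) X B^(1/2)`. -/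
lemma heinzMean_eq (hA : IsStrictlyPositive A) (hB : IsStrictlyPositive B) (s : ℝ)
    (X : H →L[ℂ] H) :
    heinzMean (1 / 2 + s) A X B = coshConj A B s (A ^ (1 / 2 : ℝ) * X * B ^ (1 / 2 : ℝ)) := by
  have h := rpow_mul_rpow_mul_mul hA hB (-s) X
  rw [neg_neg] at h
  rw [coshConj, rpow_mul_rpow_mul_mul hA hB, h, heinzMean]
  congr 3 <;> ring_nf

lemma heronMean_eq (hA : IsStrictlyPositive A) (hB : IsStrictlyPositive B) (α : ℝ)
    (X : H →L[ℂ] H) :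
    heronMean α A X B =
      (1 - α) • (A ^ (1 / 2 : ℝ) * X * B ^ (1 / 2 : ℝ)) +
        α • coshConj A B (1 / 2) (A ^ (1 / 2 : ℝ) * X * B ^ (1 / 2 : ℝ)) := by
  have hA0 := hA.nonneg
  have hB0 := hB.nonneg
  rw [← heinzMean_eq hA hB, heronMean, heinzMean, add_halves, sub_self, CFC.rpow_one A,
    CFC.rpow_one B, CFC.rpow_zero A, CFC.rpow_zero B, mul_one, one_mul]

end Means

/-! ### The inequalities between the means -/

open UnitarilyInvariantNorm UnitarilyInvariantNorm.FiniteIdeal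

theorem theorem2p2 {H : Type*} [NormedAddCommGroup H] [InnerProductSpace ℂ H] [CompleteSpace H]
    (N : UnitarilyInvariantNorm H) (A X B : H →L[ℂ] H)
    (hA : IsStrictlyPositive A) (hB : IsStrictlyPositive B)
    (hX : N X < ∞ ∨ N.IsComplete)
    (α β : ℝ) (hβ₁ : 1 / 2 ≤ β) (hβ₂ : β ≤ 1) (hα : 1 / 2 ≤ α) :
    (∀ ν : ℝ, 3 / 8 ≤ ν → ν ≤ 5 / 8 →
      N (heinzMean ν A X B) ≤
          N ((1 - β) • (A ^ (1 / 2 : ℝ) * X * B ^ (1 / 2 : ℝ)) + β • heinzMean (1 / 4) A X B) ∧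
        N ((1 - β) • (A ^ (1 / 2 : ℝ) * X * B ^ (1 / 2 : ℝ)) + β • heinzMean (1 / 4) A X B) ≤
          N (heronMean α A X B)) ∧
    (∀ ν : ℝ, 5 / 16 ≤ ν → ν ≤ 11 / 16 →
      N (heinzMean ν A X B) ≤
          N ((1 - β) • heinzMean (3 / 8) A X B + β • heinzMean (1 / 4) A X B) ∧
        N ((1 - β) • heinzMean (3 / 8) A X B + β • heinzMean (1 / 4) A X B) ≤
          N (heronMean α A X B)) := by
  have e : ∀ ν : ℝ, heinzMean ν A X B =
      coshConj A B |ν - 1 / 2| (A ^ (1 / 2 : ℝ) * X * B ^ (1 / 2 : ℝ)) := by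
    intro ν
    have h : heinzMean ν A X B = heinzMean (1 / 2 + (ν - 1 / 2)) A X B := by
      rw [add_sub_cancel]
    rw [h, heinzMean_eq hA hB]
    rcases abs_choice (ν - 1 / 2) with h | h <;> rw [h]
    rw [coshConj_neg]
  have h14 : |(1 / 4 : ℝ) - 1 / 2| = 2 * (1 / 8) := by norm_num [abs_of_neg]
  have h38 : |(3 / 8 : ℝ) - 1 / 2| = 1 / 8 := by norm_num [abs_of_neg]
  have hY : N (A ^ (1 / 2 : ℝ) * X * B ^ (1 / 2 : ℝ)) < ∞ ∨ N.IsComplete :=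
    hX.imp_left fun h => N.lt_top_mul _ (N.mul_lt_top _ h)
  simp only [heronMean_eq hA hB, e, h14, h38]
  generalize A ^ (1 / 2 : ℝ) * X * B ^ (1 / 2 : ℝ) = Y at hY ⊢
  have hα' : N.IsComplete → N ((1 - α) • Y + α • coshConj A B (1 / 2) Y) < ∞ → N Y < ∞ :=
    fun hN => lt_top_of_heron_lt_top hN hA hB hα _
  have hβ0 : 0 ≤ β := by linarith
  have h18 : (0 : ℝ) ≤ 1 / 8 := by norm_num
  -- For `Y` in the ideal, every inequality is one between vectors of `N.FiniteIdeal`.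
  refine ⟨fun ν h1 h2 => ⟨le_of_finite_of_complete hY
      (fun hN => lt_top_of_heron_lt_top hN hA hB hβ₁ _) fun h => ?_,
    le_of_finite_of_complete hY hα' fun h => ?_⟩,
    fun ν h1 h2 => ⟨le_of_finite_of_complete hY
      (fun hN => lt_top_of_heinzCombo_lt_top hN hA hB hβ₁ h18) fun h => ?_,
    le_of_finite_of_complete hY hα' fun h => ?_⟩⟩
  all_goals
    set G := N.conjGroup A B
    obtain ⟨T, rfl⟩ : ∃ T : N.FiniteIdeal, incl N T = Y := ⟨ofFinite Y h, incl_ofFinite Y h⟩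
    simp only [← N.incl_heron hA hB, ← N.incl_heinzCombo hA hB]
  · have hν : |(|ν - 1 / 2|)| ≤ 2 * (1 / 8) / 2 := by
      rw [abs_abs, abs_le]
      constructor <;> linarith
    rw [← N.incl_cosh hA hB, ← norm_le_norm_iff]
    exact (G.norm_cosh_le_norm_cosh hν T).trans (G.norm_cosh_half_le_norm_heron hβ₁ _ T)
  · have h := G.norm_cosh_half_le_norm_heron hα (1 / 2) T
    rw [show (1 / 2 / 2 : ℝ) = 2 * (1 / 8) by norm_num] at h
    rw [← norm_le_norm_iff]
    exact (G.norm_heron_le_norm_cosh hβ0 hβ₂ _ T).trans h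
  · have hν : |(|ν - 1 / 2|)| ≤ 3 * (1 / 8) / 2 := by
      rw [abs_abs, abs_le]
      constructor <;> linarith
    rw [← N.incl_cosh hA hB, ← norm_le_norm_iff]
    exact (G.norm_cosh_le_norm_cosh hν T).trans (G.norm_cosh_le_norm_heinzCombo hβ₁ h18 T)
  · have h := G.norm_cosh_half_le_norm_heron hα (1 / 2) T
    rw [show (1 / 2 / 2 : ℝ) = 2 * (1 / 8) by norm_num] at h
    rw [← norm_le_norm_iff]
    exact (G.norm_heinzCombo_le_norm_cosh hβ0 hβ₂ h18 T).trans h
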